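/- Theorem 4.1. A separable (not necessarily unital) C$^*$-algebra $\mathcal A$ is called an MF algebra if there are positive integers $n_1,n_2,\ldots$ and an embedding (an injective $*$-homomorphism, not required to be unital) of $\mathcal A$ into $\prod_k \mathcal M_{n_k}(\mathbb C)/\sum_k \mathcal M_{n_k}(\mathbb C)$, where $\prod_k \mathcal M_{n_k}(\mathbb C)$ is the C$^*$-algebra of all sequences $\langle x_k\rangle$ with $x_k\in\mathcal M_{n_k}(\mathbb C)$ and $\sup_k\|x_k\|<\infty$ (operator norms), and $\sum_k \mathcal M_{n_k}(\mathbb C)$ is the closed two-sided ideal of those sequences with $\limsup_{k\to\infty}\|x_k\|=0$. Let $\mathcal A$ be an MF algebra, let $G$ be a finite group, and let $\alpha: G\to \mathrm{Aut}(\mathcal A)$ be a homomorphism into the group of $*$-automorphisms of $\mathcal A$. Then the crossed product $\mathcal A\rtimes_\alpha G$ is an MF algebra. Here $\mathcal A\rtimes_\alpha G$ is the $*$-algebra of all functions $f:G\to\mathcal A$ with $(f*g)(s)=\sum_{t\in G} f(t)\,\alpha_t(g(t^{-1}s))$ and $f^*(s)=\alpha_s(f(s^{-1})^*)$, with the full crossed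 product norm (the largest C$^*$-seminorm bounded by the norm $f\mapsto\sum_{s\in G}\|f(s)\|$), which coincides with the reduced one, as $G$ is finite. -/

import Mathlib

open scoped ENNReal
open Filter Topology

noncomputable section

/-! ### The corona algebra of a sequence of C⋆-algebras -/

section Corona

variable (A : ℕ → Type*) [∀ k, NonUnitalCStarAlgebra (A k)]

/-- The sequences `⟨x_k⟩` in the direct product `∏ₖ A k` (all bounded sequences, with the sup
norm: this is `lp A ∞`) with `limsup ‖x_k‖ = 0`. -/
def nullSequences : Submodule ℂ (lp A ∞) where
  carrier := {x | Tendsto (fun k => ‖x k‖) atTop (𝓝 0)}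
  zero_mem' := by simp
  add_mem' {x y} hx hy := by
    refine squeeze_zero (fun k => norm_nonneg _) (fun k => ?_) (by simpa using hx.add hy)
    exact norm_add_le (x k) (y k)
  smul_mem' c x hx := by
    refine squeeze_zero (fun k => norm_nonneg _) (fun k => ?_) (by simpa using hx.const_mul ‖c‖)
    exact (norm_smul c (x k)).le

/-- The quotient `∏ₖ A k / ∑ₖ A k` of the bounded sequences by the null sequences. -/
def Corona : Type _ := lp A ∞ ⧸ nullSequences A

variable {A}

theorem mem_nullSequences {x : lp A ∞} :
    x ∈ nullSequences A ↔ Tendsto (fun k => ‖x k‖) atTop (𝓝 0) := Iff.rfl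

theorem nullSequences_mul_left (x : lp A ∞) {y : lp A ∞} (hy : y ∈ nullSequences A) :
    x * y ∈ nullSequences A := by
  rw [mem_nullSequences] at hy ⊢
  refine squeeze_zero (fun k => norm_nonneg _) (fun k => ?_) (by simpa using hy.const_mul ‖x‖)
  calc ‖(x * y) k‖ ≤ ‖x k‖ * ‖y k‖ := norm_mul_le (x k) (y k)
    _ ≤ ‖x‖ * ‖y k‖ := by
      gcongr
      exact lp.norm_apply_le_norm ENNReal.top_ne_zero x k

theorem nullSequences_star {x : lp A ∞} (hx : x ∈ nullSequences A) :
    star x ∈ nullSequences A := by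
  rw [mem_nullSequences] at hx ⊢
  simpa using hx

theorem nullSequences_mul_right {x : lp A ∞} (y : lp A ∞) (hx : x ∈ nullSequences A) :
    x * y ∈ nullSequences A := by
  simpa using nullSequences_star (nullSequences_mul_left (star y) (nullSequences_star hx))

variable (A) in
theorem isClosed_nullSequences : IsClosed (nullSequences A : Set (lp A ∞)) := by
  refine isClosed_of_closure_subset fun x hx => ?_
  rw [SetLike.mem_coe, mem_nullSequences, Metric.tendsto_atTop]
  intro ε hε
  obtain ⟨y, hy, hxy⟩ := Metric.mem_closure_iff.1 hx (ε / 2) (half_pos hε)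
  obtain ⟨N, hN⟩ := Metric.tendsto_atTop.1 (mem_nullSequences.1 hy) (ε / 2) (half_pos hε)
  refine ⟨N, fun k hk => ?_⟩
  have h1 := hN k hk
  have h2 : ‖x k - y k‖ ≤ ‖x - y‖ := lp.norm_apply_le_norm ENNReal.top_ne_zero (x - y) k
  have h3 : ‖x k‖ ≤ ‖x k - y k‖ + ‖y k‖ := by simpa using norm_add_le (x k - y k) (y k)
  rw [dist_eq_norm] at hxy
  rw [Real.dist_eq, sub_zero, abs_norm] at h1 ⊢
  linarith

instance : IsClosed (nullSequences A : Set (lp A ∞)) := isClosed_nullSequences A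

namespace Corona

instance : NormedAddCommGroup (Corona A) :=
  inferInstanceAs (NormedAddCommGroup (lp A ∞ ⧸ nullSequences A))

instance : NormedSpace ℂ (Corona A) :=
  inferInstanceAs (NormedSpace ℂ (lp A ∞ ⧸ nullSequences A))

instance : CompleteSpace (Corona A) :=
  inferInstanceAs (CompleteSpace (lp A ∞ ⧸ nullSequences A))

variable (A) in
/-- The canonical quotient map `∏ₖ A k → ∏ₖ A k / ∑ₖ A k`. -/
def mk : lp A ∞ →ₗ[ℂ] Corona A := (nullSequences A).mkQ

theorem mk_surjective : Function.Surjective (mk A) := (nullSequences A).mkQ_surjective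

theorem mk_eq_mk {x y : lp A ∞} : mk A x = mk A y ↔ x - y ∈ nullSequences A :=
  Submodule.Quotient.eq (nullSequences A)

theorem norm_mk_le (x : lp A ∞) : ‖mk A x‖ ≤ ‖x‖ :=
  Submodule.Quotient.norm_mk_le (S := nullSequences A) x

theorem exists_norm_lt (X : Corona A) {ε : ℝ} (hε : 0 < ε) :
    ∃ x, mk A x = X ∧ ‖x‖ < ‖X‖ + ε :=
  Submodule.Quotient.norm_mk_lt (S := nullSequences A) X hε

instance : Mul (Corona A) where
  mul := Quotient.map₂ (· * ·) fun x x' hx y y' hy => by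
    have hx' : x - x' ∈ nullSequences A := (nullSequences A).quotientRel_def.1 hx
    have hy' : y - y' ∈ nullSequences A := (nullSequences A).quotientRel_def.1 hy
    refine (nullSequences A).quotientRel_def.2 ?_
    have : x * y - x' * y' = (x - x') * y + x' * (y - y') := by noncomm_ring
    rw [this]
    exact add_mem (nullSequences_mul_right y hx') (nullSequences_mul_left x' hy')

instance : Star (Corona A) where
  star := Quotient.map star fun x x' hx => by
    have hx' : x - x' ∈ nullSequences A := (nullSequences A).quotientRel_def.1 hx
    refine (nullSequences A).quotientRel_def.2 ?_
    rw [← star_sub]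
    exact nullSequences_star hx'

theorem mk_mul (x y : lp A ∞) : mk A (x * y) = mk A x * mk A y := rfl

theorem mk_star (x : lp A ∞) : mk A (star x) = star (mk A x) := rfl

instance : NonUnitalRing (Corona A) :=
  { (inferInstance : AddCommGroup (Corona A)),
    mk_surjective.nonUnitalRing (mk A) (map_zero _) (map_add _) mk_mul (map_neg _) (map_sub _)
      (fun n x => map_nsmul (mk A) n x) (fun n x => map_zsmul (mk A) n x) with }

instance : StarRing (Corona A) where
  star_involutive X := by
    obtain ⟨x, rfl⟩ := mk_surjective X
    rw [← mk_star, ← mk_star, star_star]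
  star_mul X Y := by
    obtain ⟨x, rfl⟩ := mk_surjective X
    obtain ⟨y, rfl⟩ := mk_surjective Y
    rw [← mk_mul, ← mk_star, star_mul, mk_mul, mk_star, mk_star]
  star_add X Y := by
    obtain ⟨x, rfl⟩ := mk_surjective X
    obtain ⟨y, rfl⟩ := mk_surjective Y
    rw [← map_add, ← mk_star, star_add, map_add, mk_star, mk_star]

instance : StarModule ℂ (Corona A) where
  star_smul c X := by
    obtain ⟨x, rfl⟩ := mk_surjective X
    rw [← map_smul, ← mk_star, star_smul, map_smul, mk_star]

instance : IsScalarTower ℂ (Corona A) (Corona A) where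
  smul_assoc c X Y := by
    obtain ⟨x, rfl⟩ := mk_surjective X
    obtain ⟨y, rfl⟩ := mk_surjective Y
    simp only [smul_eq_mul, ← map_smul, ← mk_mul, smul_mul_assoc]

instance : SMulCommClass ℂ (Corona A) (Corona A) where
  smul_comm c X Y := by
    obtain ⟨x, rfl⟩ := mk_surjective X
    obtain ⟨y, rfl⟩ := mk_surjective Y
    simp only [smul_eq_mul, ← map_smul, ← mk_mul, mul_smul_comm]

instance : NonUnitalNormedRing (Corona A) where
  dist_eq := NormedAddCommGroup.dist_eq
  norm_mul_le X Y := by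
    refine le_of_forall_pos_le_add fun ε hε => ?_
    have hc : Tendsto (fun δ : ℝ => (‖X‖ + δ) * (‖Y‖ + δ)) (𝓝[>] 0) (𝓝 (‖X‖ * ‖Y‖)) := by
      have : Continuous fun δ : ℝ => (‖X‖ + δ) * (‖Y‖ + δ) := by fun_prop
      simpa using (this.tendsto 0).mono_left nhdsWithin_le_nhds
    obtain ⟨δ, hδ, hδ0⟩ := ((hc.eventually (gt_mem_nhds (lt_add_of_pos_right _ hε))).and
      self_mem_nhdsWithin).exists
    obtain ⟨x, rfl, hx⟩ := exists_norm_lt X hδ0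
    obtain ⟨y, rfl, hy⟩ := exists_norm_lt Y hδ0
    calc ‖mk A x * mk A y‖ ≤ ‖x * y‖ := by rw [← mk_mul]; exact norm_mk_le _
      _ ≤ ‖x‖ * ‖y‖ := norm_mul_le x y
      _ ≤ (‖mk A x‖ + δ) * (‖mk A y‖ + δ) := by gcongr
      _ ≤ _ := hδ.le

theorem norm_mk_le_of_eventually {x : lp A ∞} {r : ℝ} (hr : 0 ≤ r)
    (h : ∀ᶠ k in atTop, ‖x k‖ ≤ r) : ‖mk A x‖ ≤ r := by
  classical
  obtain ⟨N, hN⟩ := eventually_atTop.1 h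
  let y : ∀ k, A k := fun k => if k < N then 0 else x k
  have hy : ∀ k, ‖y k‖ ≤ r := fun k => by
    by_cases hk : k < N
    · simpa [y, hk] using hr
    · simpa [y, hk] using hN k (not_lt.1 hk)
  let y' : lp A ∞ := ⟨y, memℓp_infty ⟨r, by rintro _ ⟨k, rfl⟩; exact hy k⟩⟩
  have hxy : mk A x = mk A y' := by
    rw [mk_eq_mk, mem_nullSequences]
    refine tendsto_const_nhds.congr' ?_
    filter_upwards [eventually_ge_atTop N] with k hk
    have : (x - y') k = x k - y k := rfl
    simp [this, y, not_lt.2 hk]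
  rw [hxy]
  exact (norm_mk_le y').trans (lp.norm_le_of_forall_le hr hy)

instance : CStarRing (Corona A) where
  norm_mul_self_le X := by
    refine le_of_forall_pos_le_add fun ε hε => ?_
    obtain ⟨x, rfl⟩ := mk_surjective X
    obtain ⟨z, hz, hzn⟩ := exists_norm_lt (star (mk A x) * mk A x) (half_pos hε)
    rw [← mk_star, ← mk_mul] at hz hzn ⊢
    set s := ‖mk A (star x * x)‖ with hs
    have hs0 : 0 ≤ s := norm_nonneg _
    have hlt := (mem_nullSequences.1 (mk_eq_mk.1 hz)).eventually (gt_mem_nhds (half_pos hε))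
    have hx : ‖mk A x‖ ≤ Real.sqrt (s + ε) := by
      refine norm_mk_le_of_eventually (Real.sqrt_nonneg _) ?_
      filter_upwards [hlt] with k hk
      refine Real.le_sqrt_of_sq_le ?_
      have h1 : ‖star (x k) * x k‖ = ‖x k‖ * ‖x k‖ := CStarRing.norm_star_mul_self
      have h2 : (z - star x * x) k = z k - star (x k) * x k := rfl
      have h3 : ‖z k‖ ≤ ‖z‖ := lp.norm_apply_le_norm ENNReal.top_ne_zero z k
      have h4 : ‖star (x k) * x k‖ ≤ ‖z k‖ + ‖z k - star (x k) * x k‖ := by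
        simpa using norm_sub_le (z k) (z k - star (x k) * x k)
      rw [h2] at hk
      rw [sq, ← h1]
      linarith
    calc ‖mk A x‖ * ‖mk A x‖ ≤ Real.sqrt (s + ε) * Real.sqrt (s + ε) := by gcongr
      _ = s + ε := Real.mul_self_sqrt (by positivity)

/-- `∏ₖ A k / ∑ₖ A k` is a C⋆-algebra. -/
instance : NonUnitalCStarAlgebra (Corona A) where

end Corona

end Corona

/-! ### MF algebras -/

section MF

open scoped Matrix.Norms.L2Operator

/-- A C⋆-algebra is an MF algebra if it is separable and embeds (by an injective, hence isometric,
not necessarily unital `*`-homomorphism) into `∏ₖ M_{n k}(ℂ) / ∑ₖ M_{n k}(ℂ)` for some positive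
integers `n k`. Matrices carry the operator norm. -/
def IsMF (A : Type*) [NonUnitalCStarAlgebra A] : Prop :=
  TopologicalSpace.SeparableSpace A ∧
    ∃ n : ℕ → ℕ, (∀ k, 0 < n k) ∧
      ∃ φ : A →⋆ₙₐ[ℂ] Corona (fun k => Matrix (Fin (n k)) (Fin (n k)) ℂ),
        Function.Injective φ

end MF

/-! ### The crossed product by a finite group -/

section CrossedProduct

variable {A G : Type*} [NonUnitalCStarAlgebra A] [Group G]

/-- The underlying space of the crossed product `A ⋊_α G` of a C⋆-algebra `A` by an action `α` of a
finite group `G`: as `G` is finite, all functions `G → A`; `f` stands for the formal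
sum `∑ s, f s · u_s`. It carries the twisted convolution product and involution and the
(full) C⋆-norm defined below. -/
def CrossedProduct (_α : G →* (A ≃⋆ₐ[ℂ] A)) : Type _ := G → A

namespace CrossedProduct

variable {α : G →* (A ≃⋆ₐ[ℂ] A)}

instance : FunLike (CrossedProduct α) G A where
  coe f := f
  coe_injective _ _ h := h

instance : AddCommGroup (CrossedProduct α) := inferInstanceAs (AddCommGroup (G → A))

instance : Module ℂ (CrossedProduct α) := inferInstanceAs (Module ℂ (G → A))

variable (α) in
/-- A function `G → A` as an element of the crossed product. -/
def of : (G → A) ≃ₗ[ℂ] CrossedProduct α := LinearEquiv.refl ℂ (G → A)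

@[simp] theorem of_apply (f : G → A) (s : G) : of α f s = f s := rfl
@[simp] theorem zero_apply (s : G) : (0 : CrossedProduct α) s = 0 := rfl
@[simp] theorem add_apply (f g : CrossedProduct α) (s : G) : (f + g) s = f s + g s := rfl
@[simp] theorem neg_apply (f : CrossedProduct α) (s : G) : (-f) s = -f s := rfl
@[simp] theorem sub_apply (f g : CrossedProduct α) (s : G) : (f - g) s = f s - g s := rfl
@[simp] theorem smul_apply (c : ℂ) (f : CrossedProduct α) (s : G) : (c • f) s = c • f s := rfl

@[ext] theorem ext {f g : CrossedProduct α} (h : ∀ s, f s = g s) : f = g := DFunLike.ext _ _ h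

theorem action_mul (s t : G) (a : A) : α (s * t) a = α s (α t a) := by
  rw [map_mul, StarAlgEquiv.mul_apply]

/-- The involution `f⋆(s) = α_s (f(s⁻¹)⋆)`. -/
instance : Star (CrossedProduct α) where
  star f := of α fun s => α s (star (f s⁻¹))

theorem star_apply (f : CrossedProduct α) (s : G) : star f s = α s (star (f s⁻¹)) := rfl

/-- The regular representation of the crossed product by `G × G` matrices over `A`, that is, by
operators on the Hilbert module `ℓ²(G, A)`. -/
def regular (f : CrossedProduct α) : CStarMatrix G G A :=
  CStarMatrix.ofMatrix fun s t => α s⁻¹ (f (s * t⁻¹))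

theorem regular_apply (f : CrossedProduct α) (s t : G) :
    regular f s t = α s⁻¹ (f (s * t⁻¹)) := rfl

theorem regular_injective : Function.Injective (regular (α := α)) := fun f g h => by
  ext s
  have h1 : regular f s 1 = regular g s 1 := by rw [h]
  simpa [regular_apply] using h1

theorem regular_zero : regular (0 : CrossedProduct α) = 0 := by
  ext s t; simp [regular_apply]

theorem regular_add (f g : CrossedProduct α) : regular (f + g) = regular f + regular g := by
  ext s t; simp [regular_apply]

theorem regular_neg (f : CrossedProduct α) : regular (-f) = -regular f := by
  ext s t; simp [regular_apply]

theorem regular_sub (f g : CrossedProduct α) : regular (f - g) = regular f - regular g := by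
  ext s t; simp [regular_apply]

theorem regular_smul (c : ℂ) (f : CrossedProduct α) : regular (c • f) = c • regular f := by
  ext s t; simp [regular_apply]

theorem regular_star (f : CrossedProduct α) : regular (star f) = star (regular f) := by
  ext s t
  rw [CStarMatrix.star_apply, regular_apply, regular_apply, star_apply, ← action_mul, ← map_star]
  simp

variable [Fintype G]

/-- Twisted convolution `(f * g)(s) = ∑ t, f(t) α_t (g(t⁻¹ s))`. -/
instance : Mul (CrossedProduct α) where
  mul f g := of α fun s => ∑ t, f t * α t (g (t⁻¹ * s))

theorem mul_apply (f g : CrossedProduct α) (s : G) :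
    (f * g) s = ∑ t, f t * α t (g (t⁻¹ * s)) := rfl

theorem regular_mul (f g : CrossedProduct α) : regular (f * g) = regular f * regular g := by
  ext s t
  rw [CStarMatrix.mul_apply, regular_apply, mul_apply, map_sum]
  refine Fintype.sum_equiv ((Equiv.inv G).trans (Equiv.mulRight s)) _ _ fun r => ?_
  simp only [regular_apply, map_mul (α s⁻¹), ← action_mul, Equiv.trans_apply, Equiv.inv_apply,
    Equiv.coe_mulRight]
  simp [mul_assoc]

instance : NonUnitalRing (CrossedProduct α) :=
  { (inferInstance : AddCommGroup (CrossedProduct α)),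
    regular_injective.nonUnitalRing regular regular_zero regular_add regular_mul regular_neg
      regular_sub
      (fun n x => map_nsmul (AddMonoidHom.mk' (regular (α := α)) regular_add) n x)
      (fun n x => map_zsmul (AddMonoidHom.mk' (regular (α := α)) regular_add) n x) with }

instance : StarRing (CrossedProduct α) where
  star_involutive f := regular_injective (by simp [regular_star])
  star_mul f g := regular_injective (by simp [regular_star, regular_mul])
  star_add f g := regular_injective (by simp [regular_star, regular_add])

instance : StarModule ℂ (CrossedProduct α) where
  star_smul c f := regular_injective (by simp [regular_star, regular_smul])

instance : IsScalarTower ℂ (CrossedProduct α) (CrossedProduct α) where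
  smul_assoc c f g := by
    ext s
    simp [mul_apply, Finset.smul_sum, smul_mul_assoc]

instance : SMulCommClass ℂ (CrossedProduct α) (CrossedProduct α) where
  smul_comm c f g := by
    ext s
    simp [mul_apply, Finset.smul_sum, mul_smul_comm]

variable (α) in
/-- The C⋆-seminorms on the convolution algebra that are bounded by the `ℓ¹`-norm. These are the
seminorms `f ↦ ‖π f‖` of the `ℓ¹`-contractive `*`-representations `π`, that is, of the integrated
forms of the covariant representations of `(A, G, α)`. -/
def cstarSeminorms : Set (Seminorm ℂ (CrossedProduct α)) :=
  {p | (∀ f g, p (f * g) ≤ p f * p g) ∧ (∀ f, p (star f * f) = p f ^ 2) ∧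
    ∀ f, p f ≤ ∑ s, ‖f s‖}

/-- The norm of the full crossed product: the enveloping C⋆-norm, which is the supremum of all
C⋆-seminorms. -/
instance : Norm (CrossedProduct α) where
  norm f := sSup ((fun p : Seminorm ℂ (CrossedProduct α) => p f) '' cstarSeminorms α)

theorem bddAbove_cstarSeminorms (f : CrossedProduct α) :
    BddAbove ((fun p : Seminorm ℂ (CrossedProduct α) => p f) '' cstarSeminorms α) :=
  ⟨∑ s, ‖f s‖, by rintro _ ⟨p, hp, rfl⟩; exact hp.2.2 f⟩

theorem le_norm {p : Seminorm ℂ (CrossedProduct α)} (hp : p ∈ cstarSeminorms α)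
    (f : CrossedProduct α) : p f ≤ ‖f‖ :=
  le_csSup (bddAbove_cstarSeminorms f) ⟨p, hp, rfl⟩

theorem norm_nonneg' (f : CrossedProduct α) : 0 ≤ ‖f‖ :=
  Real.sSup_nonneg (by rintro _ ⟨p, -, rfl⟩; exact apply_nonneg p f)

theorem norm_le' {f : CrossedProduct α} {C : ℝ} (hC : 0 ≤ C)
    (h : ∀ p ∈ cstarSeminorms α, p f ≤ C) : ‖f‖ ≤ C :=
  Real.sSup_le (by rintro _ ⟨p, hp, rfl⟩; exact h p hp) hC

theorem norm_le_sum (f : CrossedProduct α) : ‖f‖ ≤ ∑ s, ‖f s‖ :=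
  norm_le' (Finset.sum_nonneg fun _ _ => norm_nonneg _) fun _ hp => hp.2.2 f

section Regular

attribute [local instance] CStarAlgebra.spectralOrder CStarAlgebra.spectralOrderedRing

/-- The regular representation is contractive on the copy of `A` at the identity of `G`. -/
theorem norm_regular_le_of_support_one (f : CrossedProduct α) (hf : ∀ s, s ≠ 1 → f s = 0) :
    ‖regular f‖ ≤ ‖f 1‖ := by
  classical
  let φ : A →⋆ₙₐ[ℂ] CStarMatrix G G A :=
    { toFun a := regular (of α (Pi.single 1 a))
      map_smul' c a := by simp only [Pi.single_smul, map_smul, regular_smul]; rfl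
      map_zero' := by simp only [Pi.single_zero, map_zero, regular_zero]
      map_add' a b := by simp only [Pi.single_add, map_add, regular_add]
      map_mul' a b := by
        rw [← regular_mul]
        congr 1
        ext s
        rw [mul_apply, Finset.sum_eq_single 1 (by intro t _ ht; simp [ht]) (by simp)]
        by_cases hs : s = 1 <;> simp [hs]
      map_star' a := by
        rw [← regular_star]
        congr 1
        ext s
        by_cases hs : s = 1 <;> simp [star_apply, hs] }
  have hfφ : regular f = φ (f 1) := by
    change regular f = regular (of α (Pi.single 1 (f 1)))
    congr 1
    ext s
    by_cases hs : s = 1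
    · simp [hs]
    · simp [hs, hf s hs]
  rw [hfφ]
  exact NonUnitalStarAlgHom.norm_apply_le φ (f 1)

theorem norm_regular_le (f : CrossedProduct α) : ‖regular f‖ ≤ ∑ s, ‖f s‖ := by
  classical
  have key : ∀ (s : G) (a : A), ‖regular (of α (Pi.single s a))‖ ≤ ‖a‖ := fun s a => by
    set x := of α (Pi.single s a) with hx
    have hmul : ∀ t, (x * star x) t = if t = 1 then a * star a else 0 := fun t => by
      rw [mul_apply, Finset.sum_eq_single s (by intro r _ hr; simp [hx, hr]) (by simp)]
      by_cases ht : t = 1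
      · subst ht
        have hs : α s (α s⁻¹ (star a)) = star a := by rw [← action_mul]; simp
        simpa [hx, star_apply] using congrArg (a * ·) hs
      · have : t⁻¹ * s ≠ s := by simpa using ht
        simp [hx, star_apply, this, ht]
    have h1 : ‖regular x‖ * ‖regular x‖ ≤ ‖a‖ * ‖a‖ := by
      rw [← CStarRing.norm_self_mul_star, ← regular_star, ← regular_mul]
      refine (norm_regular_le_of_support_one _ fun t ht => by simp [hmul, ht]).trans ?_
      rw [hmul, if_pos rfl, CStarRing.norm_self_mul_star]
    exact le_of_sq_le_sq (by simpa [sq] using h1) (norm_nonneg a)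
  have hsum : regular f = ∑ s, regular (of α (Pi.single s (f s))) := by
    have h := map_sum (AddMonoidHom.mk' (regular (α := α)) regular_add)
      (fun s => of α (Pi.single s (f s))) Finset.univ
    have h' : f = ∑ s, of α (Pi.single s (f s)) := by
      rw [← map_sum, Finset.univ_sum_single fun s => f s]; rfl
    conv_lhs => rw [h']
    exact h
  rw [hsum]
  exact (norm_sum_le _ _).trans (Finset.sum_le_sum fun s _ => key s (f s))

variable (α) in
/-- The C⋆-seminorm of the regular representation. -/
def regularSeminorm : Seminorm ℂ (CrossedProduct α) :=
  Seminorm.of (fun f => ‖regular f‖) (fun f g => by rw [regular_add]; exact norm_add_le _ _)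
    (fun c f => by rw [regular_smul, norm_smul])

theorem regularSeminorm_mem : regularSeminorm α ∈ cstarSeminorms α := by
  refine ⟨fun f g => ?_, fun f => ?_, norm_regular_le⟩
  · change ‖regular (f * g)‖ ≤ ‖regular f‖ * ‖regular g‖
    rw [regular_mul]
    exact norm_mul_le _ _
  · change ‖regular (star f * f)‖ = ‖regular f‖ ^ 2
    rw [regular_mul, regular_star, CStarRing.norm_star_mul_self, sq]

theorem norm_apply_le_norm (f : CrossedProduct α) (s : G) : ‖f s‖ ≤ ‖f‖ := by
  have h1 : regular f 1 s⁻¹ = f s := by simp [regular_apply]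
  calc ‖f s‖ = ‖regular f 1 s⁻¹‖ := by rw [h1]
    _ ≤ ‖regular f‖ := CStarMatrix.norm_entry_le_norm
    _ ≤ ‖f‖ := le_norm regularSeminorm_mem f

end Regular

theorem normedSpaceCore : NormedSpace.Core ℂ (CrossedProduct α) where
  norm_nonneg := norm_nonneg'
  norm_smul c f := by
    have h : ∀ (c : ℂ) (f : CrossedProduct α), ‖c • f‖ ≤ ‖c‖ * ‖f‖ := fun c f =>
      norm_le' (mul_nonneg (norm_nonneg c) (norm_nonneg' f)) fun p hp => by
        rw [map_smul_eq_mul]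
        exact mul_le_mul_of_nonneg_left (le_norm hp f) (norm_nonneg c)
    refine le_antisymm (h c f) ?_
    rcases eq_or_ne c 0 with rfl | hc
    · simpa using norm_nonneg' ((0 : ℂ) • f)
    · have h2 := h c⁻¹ (c • f)
      rw [smul_smul, inv_mul_cancel₀ hc, one_smul, norm_inv] at h2
      rwa [← le_inv_mul_iff₀ (norm_pos_iff.2 hc)]
  norm_triangle f g := norm_le' (add_nonneg (norm_nonneg' f) (norm_nonneg' g)) fun p hp =>
    (map_add_le_add p f g).trans (add_le_add (le_norm hp f) (le_norm hp g))
  norm_eq_zero_iff f := by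
    refine ⟨fun h => ?_, fun h => ?_⟩
    · ext s
      exact norm_le_zero_iff.1 (h ▸ norm_apply_le_norm f s)
    · subst h
      exact le_antisymm ((norm_le_sum _).trans (by simp)) (norm_nonneg' _)

instance : NormedAddCommGroup (CrossedProduct α) := NormedAddCommGroup.ofCore normedSpaceCore

instance : NormedSpace ℂ (CrossedProduct α) := NormedSpace.ofCore normedSpaceCore

instance : NonUnitalNormedRing (CrossedProduct α) where
  dist_eq := NormedAddCommGroup.dist_eq
  norm_mul_le f g := norm_le' (mul_nonneg (norm_nonneg f) (norm_nonneg g)) fun p hp =>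
    (hp.1 f g).trans (mul_le_mul (le_norm hp f) (le_norm hp g) (apply_nonneg p g) (norm_nonneg f))

instance : CStarRing (CrossedProduct α) where
  norm_mul_self_le f := by
    have h : ‖f‖ ≤ Real.sqrt ‖star f * f‖ := norm_le' (Real.sqrt_nonneg _) fun p hp =>
      Real.le_sqrt_of_sq_le ((hp.2.1 f).symm.le.trans (le_norm hp _))
    calc ‖f‖ * ‖f‖ ≤ Real.sqrt ‖star f * f‖ * Real.sqrt ‖star f * f‖ := by gcongr
      _ = ‖star f * f‖ := Real.mul_self_sqrt (norm_nonneg _)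

instance : CompleteSpace (CrossedProduct α) := by
  let e : CrossedProduct α →ₗ[ℂ] (G → A) := (of α).symm.toLinearMap
  have hanti : AntilipschitzWith (Fintype.card G) e :=
    AddMonoidHomClass.antilipschitz_of_bound e fun f => by
      refine (norm_le_sum f).trans ?_
      refine (Finset.sum_le_card_nsmul Finset.univ _ ‖e f‖ fun s _ =>
        norm_le_pi_norm (e f) s).trans ?_
      simp
  have hlip : LipschitzWith 1 e :=
    AddMonoidHomClass.lipschitz_of_bound_nnnorm e 1 fun f => by
      rw [one_mul]
      exact (pi_norm_le_iff_of_nonneg (norm_nonneg f)).2 fun s => norm_apply_le_norm f s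
  have hui : IsUniformInducing e := hanti.isUniformInducing hlip.uniformContinuous
  refine hui.completeSpace ?_
  have : Set.range e = Set.univ := (of α).symm.surjective.range_eq
  rw [this]
  exact isComplete_univ

/-- The crossed product `A ⋊_α G` is a C⋆-algebra. -/
instance : NonUnitalCStarAlgebra (CrossedProduct α) where

section Reduced

attribute [local instance] CStarAlgebra.spectralOrder CStarAlgebra.spectralOrderedRing

/-- The full norm agrees with the norm of the regular representation on `ℓ²(G, A)`: the full and
the reduced crossed product coincide. -/
theorem norm_eq_norm_regular (f : CrossedProduct α) : ‖f‖ = ‖regular f‖ :=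
  let φ : CrossedProduct α →⋆ₙₐ[ℂ] CStarMatrix G G A :=
    { toFun := regular
      map_smul' := regular_smul
      map_zero' := regular_zero
      map_add' := regular_add
      map_mul' := regular_mul
      map_star' := regular_star }
  (NonUnitalStarAlgHom.norm_map φ regular_injective f).symm

end Reduced

end CrossedProduct

end CrossedProduct

end

/-!
The regular representation embeds `A ⋊ G` into the matrix algebra `M_G(A)`, so it suffices to pass
from `A` to `M_G(A)`. An embedding of `A` into `∏ₖ M_{n k}(ℂ) / ∑ₖ M_{n k}(ℂ)`, applied to each
entry, embeds `M_G(A)` into `M_G(∏ₖ M_{n k}(ℂ) / ∑ₖ M_{n k}(ℂ))`. The norm of a `G × G` matrix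
lies between the largest norm and the sum of the norms of its entries, so boundedness and
convergence to `0` can be tested entrywise, and the last algebra is
`∏ₖ M_G(M_{n k}(ℂ)) / ∑ₖ M_G(M_{n k}(ℂ))`, whose `k`th factor is a full matrix algebra of size
`|G| n k`.
-/

noncomputable section

open scoped Matrix.Norms.L2Operator MatrixOrder

namespace Corona

section Functoriality

variable {B C : ℕ → Type*} [∀ k, NonUnitalCStarAlgebra (B k)] [∀ k, NonUnitalCStarAlgebra (C k)]
  {D : Type*} [NonUnitalRing D] [Module ℂ D] [Star D]

theorem mk_eq_zero {x : lp B ∞} : mk B x = 0 ↔ x ∈ nullSequences B := by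
  rw [← map_zero (mk B), mk_eq_mk, sub_zero]

variable (B) in
/-- The quotient map `mk` as a `*`-homomorphism. -/
def mkHom : lp B ∞ →⋆ₙₐ[ℂ] Corona B where
  __ := mk B
  map_zero' := map_zero (mk B)
  map_mul' := mk_mul
  map_star' := mk_star

/-- The universal property of the quotient `∏ₖ B k / ∑ₖ B k`: the factorization of a
`*`-homomorphism that vanishes on the null sequences. -/
def lift (f : lp B ∞ →⋆ₙₐ[ℂ] D) (hf : ∀ x ∈ nullSequences B, f x = 0) : Corona B →⋆ₙₐ[ℂ] D :=
  let g : Corona B →ₗ[ℂ] D := (nullSequences B).liftQ (f : lp B ∞ →ₗ[ℂ] D) hf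
  { g with
    map_zero' := map_zero g
    map_mul' X Y := by
      obtain ⟨x, rfl⟩ := mk_surjective X
      obtain ⟨y, rfl⟩ := mk_surjective Y
      exact map_mul f x y
    map_star' X := by
      obtain ⟨x, rfl⟩ := mk_surjective X
      exact map_star f x }

theorem lift_injective {f : lp B ∞ →⋆ₙₐ[ℂ] D} (hf : ∀ x ∈ nullSequences B, f x = 0)
    (hker : ∀ x, f x = 0 → x ∈ nullSequences B) : Function.Injective (lift f hf) := by
  refine (injective_iff_map_eq_zero _).2 fun X hX => ?_
  obtain ⟨x, rfl⟩ := mk_surjective X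
  exact mk_eq_zero.2 (hker x hX)

theorem lift_surjective {f : lp B ∞ →⋆ₙₐ[ℂ] D} (hf : ∀ x ∈ nullSequences B, f x = 0)
    (hsurj : Function.Surjective f) : Function.Surjective (lift f hf) := fun y => by
  obtain ⟨x, rfl⟩ := hsurj y
  exact ⟨mk B x, rfl⟩

/-- The coordinatewise `*`-homomorphism of bounded sequences induced by `*`-homomorphisms
`B k → C k`. -/
def boundedMap (φ : ∀ k, B k →⋆ₙₐ[ℂ] C k) : lp B ∞ →⋆ₙₐ[ℂ] lp C ∞ where
  toFun x := ⟨fun k => φ k (x k), memℓp_infty ⟨‖x‖, by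
    rintro _ ⟨k, rfl⟩
    exact (NonUnitalStarAlgHom.norm_apply_le (φ k) (x k)).trans
      (lp.norm_apply_le_norm ENNReal.top_ne_zero x k)⟩⟩
  map_smul' c x := lp.ext <| funext fun k => map_smul (φ k) c (x k)
  map_zero' := lp.ext <| funext fun k => map_zero (φ k)
  map_add' x y := lp.ext <| funext fun k => map_add (φ k) (x k) (y k)
  map_mul' x y := lp.ext <| funext fun k => map_mul (φ k) (x k) (y k)
  map_star' x := lp.ext <| funext fun k => map_star (φ k) (x k)

/-- The `*`-homomorphism `∏ₖ B k / ∑ₖ B k → ∏ₖ C k / ∑ₖ C k` induced by `*`-homomorphisms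
`B k → C k`. -/
def map (φ : ∀ k, B k →⋆ₙₐ[ℂ] C k) : Corona B →⋆ₙₐ[ℂ] Corona C :=
  lift ((mkHom C).comp (boundedMap φ)) fun _ hx => mk_eq_zero.2 <| mem_nullSequences.2 <|
    squeeze_zero (fun _ => norm_nonneg _) (fun k => NonUnitalStarAlgHom.norm_apply_le (φ k) _)
      (mem_nullSequences.1 hx)

theorem map_injective {φ : ∀ k, B k →⋆ₙₐ[ℂ] C k} (hφ : ∀ k, Function.Injective (φ k)) :
    Function.Injective (map φ) := by
  refine lift_injective _ fun x hx => mem_nullSequences.2 ?_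
  have hnorm (k : ℕ) : ‖boundedMap φ x k‖ = ‖x k‖ := NonUnitalStarAlgHom.norm_map (φ k) (hφ k) (x k)
  exact (tendsto_congr hnorm).1 (mem_nullSequences.1 (mk_eq_zero.1 hx))

end Functoriality

end Corona

section CStarMatrix

variable {m n A : Type*} [Fintype m] [Fintype n] [NonUnitalCStarAlgebra A] [PartialOrder A]
  [StarOrderedRing A]

theorem norm_cstarMatrix_le_sum (M : CStarMatrix m n A) : ‖M‖ ≤ ∑ j, ∑ i, ‖M i j‖ := by
  rw [CStarMatrix.norm_def]
  refine (CStarMatrix.toCLM M).opNorm_le_bound (by positivity) fun v => ?_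
  calc ‖CStarMatrix.toCLM M v‖ ≤ ∑ j, ‖∑ i, v i * M i j‖ := by
        rw [CStarMatrix.toCLM_apply_eq_sum]
        exact WithCStarModule.pi_norm_le_sum_norm _
    _ ≤ ∑ j, ∑ i, ‖v‖ * ‖M i j‖ := by
        gcongr with j
        refine norm_sum_le_of_le _ fun i _ => (norm_mul_le _ _).trans ?_
        gcongr
        exact WithCStarModule.norm_apply_le_norm v i
    _ = (∑ j, ∑ i, ‖M i j‖) * ‖v‖ := by simp only [Finset.sum_mul, mul_comm ‖v‖]

end CStarMatrix

namespace Corona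

section MatrixEntries

variable {ι : Type*} [Fintype ι] {B : ℕ → Type*} [∀ k, NonUnitalCStarAlgebra (B k)]
  [∀ k, PartialOrder (B k)] [∀ k, StarOrderedRing (B k)]

/-- The `(i, j)` entries of a bounded sequence of matrices. -/
def entrySequence (i j : ι) : lp (fun k => CStarMatrix ι ι (B k)) ∞ →ₗ[ℂ] lp B ∞ where
  toFun x := ⟨fun k => x k i j, memℓp_infty ⟨‖x‖, by
    rintro _ ⟨k, rfl⟩
    exact CStarMatrix.norm_entry_le_norm.trans (lp.norm_apply_le_norm ENNReal.top_ne_zero x k)⟩⟩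
  map_add' _ _ := rfl
  map_smul' _ _ := rfl

theorem entrySequence_mul (x y : lp (fun k => CStarMatrix ι ι (B k)) ∞) (i j : ι) :
    entrySequence i j (x * y) = ∑ l, entrySequence i l x * entrySequence l j y := by
  refine lp.ext <| funext fun k => ?_
  rw [lp.coeFn_sum, Finset.sum_apply]
  rfl

theorem exists_forall_entrySequence_eq (y : ι → ι → lp B ∞) :
    ∃ x : lp (fun k => CStarMatrix ι ι (B k)) ∞, ∀ i j, entrySequence i j x = y i j := by
  refine ⟨⟨fun k => CStarMatrix.ofMatrix fun i j => y i j k,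
    memℓp_infty ⟨∑ j, ∑ i, ‖y i j‖, ?_⟩⟩, fun _ _ => rfl⟩
  rintro _ ⟨k, rfl⟩
  refine (norm_cstarMatrix_le_sum _).trans ?_
  gcongr with j _ i
  exact lp.norm_apply_le_norm ENNReal.top_ne_zero (y i j) k

theorem forall_entrySequence_mem_nullSequences {x : lp (fun k => CStarMatrix ι ι (B k)) ∞} :
    (∀ i j, entrySequence i j x ∈ nullSequences B) ↔
      x ∈ nullSequences fun k => CStarMatrix ι ι (B k) := by
  simp only [mem_nullSequences]
  constructor <;> intro h
  · refine squeeze_zero (fun _ => norm_nonneg _) (fun k => norm_cstarMatrix_le_sum (x k)) ?_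
    have hsum : Tendsto (fun k => ∑ j, ∑ i, ‖entrySequence i j x k‖) atTop
        (𝓝 (∑ _j : ι, ∑ _i : ι, 0)) :=
      tendsto_finsetSum _ fun j _ => tendsto_finsetSum _ fun i _ => h i j
    rwa [Finset.sum_const_zero, Finset.sum_const_zero] at hsum
  · exact fun i j => squeeze_zero (fun _ => norm_nonneg _)
      (fun k => CStarMatrix.norm_entry_le_norm) h

variable (ι B) in
/-- The matrix over `∏ₖ B k / ∑ₖ B k` represented by a bounded sequence of matrices. -/
def entries : lp (fun k => CStarMatrix ι ι (B k)) ∞ →⋆ₙₐ[ℂ] CStarMatrix ι ι (Corona B) where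
  toFun x := CStarMatrix.ofMatrix fun i j => mk B (entrySequence i j x)
  map_smul' _ _ := CStarMatrix.ext fun _ _ => rfl
  map_zero' := CStarMatrix.ext fun _ _ => rfl
  map_add' _ _ := CStarMatrix.ext fun _ _ => rfl
  map_mul' x y := CStarMatrix.ext fun i j => by
    change mk B (entrySequence i j (x * y)) =
      ∑ l, mk B (entrySequence i l x) * mk B (entrySequence l j y)
    simp only [entrySequence_mul, map_sum, mk_mul]
  map_star' _ := CStarMatrix.ext fun _ _ => rfl

theorem entries_eq_zero (x : lp (fun k => CStarMatrix ι ι (B k)) ∞) :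
    entries ι B x = 0 ↔ x ∈ nullSequences fun k => CStarMatrix ι ι (B k) := by
  rw [← forall_entrySequence_mem_nullSequences, ← CStarMatrix.ext_iff]
  exact forall₂_congr fun i j => mk_eq_zero

theorem entries_surjective : Function.Surjective (entries ι B) := fun Y => by
  choose y hy using fun i j => mk_surjective (Y i j)
  obtain ⟨x, hx⟩ := exists_forall_entrySequence_eq y
  refine ⟨x, CStarMatrix.ext fun i j => ?_⟩
  rw [← hy, ← hx]
  rfl

variable (ι B) in
/-- `∏ₖ M_ι(B k) / ∑ₖ M_ι(B k)` is the algebra of `ι × ι` matrices over `∏ₖ B k / ∑ₖ B k`. -/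
def cstarMatrixEquiv : Corona (fun k => CStarMatrix ι ι (B k)) ≃⋆ₐ[ℂ] CStarMatrix ι ι (Corona B) :=
  StarAlgEquiv.ofBijective (lift (entries ι B) fun x => (entries_eq_zero x).2)
    ⟨lift_injective _ fun x => (entries_eq_zero x).1, lift_surjective _ entries_surjective⟩

end MatrixEntries

end Corona

/-- Block matrices as matrices: `M_ι(M_p(R)) ≃ M_q(R)` for an enumeration `e` of `ι × p` by `q`. -/
def flattenBlocks {ι p q S R : Type*} [Fintype ι] [Fintype p] [Fintype q]
    [NonUnitalNonAssocSemiring R] [Star R] [SMul S R] (e : ι × p ≃ q) :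
    CStarMatrix ι ι (Matrix p p R) ≃⋆ₐ[S] Matrix q q R where
  toEquiv := CStarMatrix.ofMatrix.symm.trans <|
    (Matrix.comp ι ι p p R).trans (Matrix.reindex e e)
  map_mul' M N := by
    ext a b
    let x := e.symm a
    let y := e.symm b
    change (∑ l, M x.1 l * N l y.1) x.2 y.2 = ∑ c, M x.1 (e.symm c).1 x.2 (e.symm c).2 *
      N (e.symm c).1 y.1 (e.symm c).2 y.2
    rw [e.symm.sum_comp fun z => M x.1 z.1 x.2 z.2 * N z.1 y.1 z.2 y.2, Fintype.sum_prod_type,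
      Matrix.sum_apply]
    rfl
  map_add' _ _ := rfl
  map_star' _ := rfl
  map_smul' _ _ := rfl

namespace IsMF

variable {A B : Type*} [NonUnitalCStarAlgebra A] [NonUnitalCStarAlgebra B]

theorem of_injective (hA : IsMF A) (φ : B →⋆ₙₐ[ℂ] A) (hφ : Function.Injective φ) : IsMF B := by
  obtain ⟨hsep, n, hn, ψ, hψ⟩ := hA
  have : SecondCountableTopology A := UniformSpace.secondCountable_of_separable A
  have : SecondCountableTopology B :=
    (NonUnitalStarAlgHom.isometry φ hφ).isUniformInducing.isInducing.secondCountableTopology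
  exact ⟨inferInstance, n, hn, ψ.comp φ, hψ.comp hφ⟩

theorem cstarMatrix [PartialOrder A] [StarOrderedRing A] (hA : IsMF A)
    (ι : Type*) [Fintype ι] [Nonempty ι] : IsMF (CStarMatrix ι ι A) := by
  obtain ⟨hsep, n, hn, φ, hφ⟩ := hA
  have e (k : ℕ) : ι × Fin (n k) ≃ Fin (Fintype.card ι * n k) :=
    Fintype.equivFinOfCardEq (by rw [Fintype.card_prod, Fintype.card_fin])
  let flatten := Corona.map fun k => (flattenBlocks (S := ℂ) (R := ℂ) (e k)).toNonUnitalStarAlgHom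
  have hflatten : Function.Injective flatten :=
    Corona.map_injective fun k => EquivLike.injective (flattenBlocks (S := ℂ) (R := ℂ) (e k))
  let unentries := (Corona.cstarMatrixEquiv ι fun k => Matrix (Fin (n k)) (Fin (n k)) ℂ).symm
  exact ⟨inferInstanceAs (TopologicalSpace.SeparableSpace (ι → ι → A)),
    fun k => Fintype.card ι * n k, fun k => Nat.mul_pos Fintype.card_pos (hn k),
    (flatten.comp unentries.toNonUnitalStarAlgHom).comp (CStarMatrix.mapₙₐ φ),
    (hflatten.comp (EquivLike.injective unentries)).comp (CStarMatrix.map_injective hφ)⟩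

end IsMF

namespace CrossedProduct

variable {A G : Type*} [NonUnitalCStarAlgebra A] [Group G] [Fintype G]

/-- `regular` as a `*`-homomorphism. -/
def regularHom (α : G →* (A ≃⋆ₐ[ℂ] A)) : CrossedProduct α →⋆ₙₐ[ℂ] CStarMatrix G G A where
  toFun := regular
  map_smul' := regular_smul
  map_zero' := regular_zero
  map_add' := regular_add
  map_mul' := regular_mul
  map_star' := regular_star

end CrossedProduct

end

theorem theorem4p1 {A : Type*} [NonUnitalCStarAlgebra A] {G : Type*} [Group G] [Fintype G]
    (α : G →* (A ≃⋆ₐ[ℂ] A)) (hA : IsMF A) : IsMF (CrossedProduct α) := by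
  let := CStarAlgebra.spectralOrder A
  have := CStarAlgebra.spectralOrderedRing A
  exact (hA.cstarMatrix G).of_injective (CrossedProduct.regularHom α)
    CrossedProduct.regular_injective
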